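/- Let $n\ge 2$, let $U\subseteq\mathbb R^n$ be open and connected, and let $\bar x:U\to\mathbb R^{n+1}$ be an injective immersion of class $C^3$ (or smoother) with unit normal field $\bar\xi$. Write $f_{/i}=\partial f/\partial u^i$, $f_{/ij}=\partial^2 f/\partial u^i\partial u^j$, let $g_{ij}=\langle \bar x_{/i},\bar x_{/j}\rangle$ and $h_{ij}=\langle\bar\xi,\bar x_{/ij}\rangle$ be the first and second fundamental forms, and assume that the Gaussian curvature $K=\det(h_{ij})/\det(g_{ij})$ vanishes nowhere on $U$. Let $\bar y:U\to\mathbb R^{n+1}$ be a relative normalization of class $C^1$ (or smoother): at every point $\bar y$ is not tangent to the hypersurface $\bar x(U)$, while all $\bar y_{/i}$ are tangent to it. Let $q=\langle\bar\xi,\bar y\rangle$ be its support function, let $\bar X=q^{-1}\bar\xi$ be the vector field determined by $\langle\bar X,\bar x_{/i}\rangle=0$ $(i=1,\dots,n)$ and $\langle\bar X,\bar y\rangle=1$, let $G_{ij}=\langle\bar X,\bar x_{/ij}\rangle$ be the relative metric (a possibly indefinite, nondegenerate metric on $U$), and let $$\triangle^{G}\bar x=\sum_{i,j}G^{ij}\Big(\bar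 x_{/ij}-\sum_k{}^{G}\Gamma^k_{ij}\,\bar x_{/k}\Big)$$ be the second Beltrami operator of $G$ applied to $\bar x$, where $(G^{ij})=(G_{ij})^{-1}$ and ${}^{G}\Gamma^k_{ij}$ are the Christoffel symbols of $G$. (a) If $n=2$, then $\langle\triangle^{G}\bar x,d\bar\xi\rangle=0$ at every point of $U$ if and only if $K$ is constant on $U$. (b) If $n\ge 3$, then $\langle\triangle^{G}\bar x,d\bar\xi\rangle=0$ at every point of $U$ if and only if there is a constant $\lambda\in\mathbb R\setminus\{0\}$ with $q=\lambda\,|K|^{1/(2-n)}$ on $U$. -/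

import Mathlib

noncomputable section

namespace RelGeom

/-- The coordinate space `ℝⁿ` with its Euclidean structure. -/
abbrev E (n : ℕ) : Type := EuclideanSpace ℝ (Fin n)

/-- Partial derivative `f_{/i} = ∂f/∂uⁱ` of a map on `ℝⁿ`. -/
def pd {n : ℕ} {F : Type*} [NormedAddCommGroup F] [NormedSpace ℝ F]
    (i : Fin n) (f : E n → F) (u : E n) : F :=
  fderiv ℝ f u (EuclideanSpace.single i 1)

/-- Second partial derivative `f_{/ij} = ∂²f/∂uⁱ∂uʲ`. -/
def pd2 {n : ℕ} {F : Type*} [NormedAddCommGroup F] [NormedSpace ℝ F]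
    (i j : Fin n) (f : E n → F) (u : E n) : F :=
  pd j (pd i f) u

/-- `x` restricts to an injective immersion of class `C³` of `U ⊆ ℝⁿ` into `ℝⁿ⁺¹`
(`C³` makes the relative metric of class `C¹`, so that its Christoffel symbols exist). -/
structure IsInjectiveImmersion {n : ℕ} (U : Set (E n)) (x : E n → E (n + 1)) : Prop where
  contDiffOn : ContDiffOn ℝ 3 x U
  injOn : Set.InjOn x U
  linearIndependent : ∀ u ∈ U, LinearIndependent ℝ (fun i : Fin n => pd i x u)

/-- The tangent vector space of the hypersurface at the point with parameter `u`. -/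
def tangentSpace {n : ℕ} (x : E n → E (n + 1)) (u : E n) : Submodule ℝ (E (n + 1)) :=
  Submodule.span ℝ (Set.range fun i : Fin n => pd i x u)

/-- `ξ` is a Euclidean normalization: a `C¹` field of unit normals along `x`
(either of the two orientations). -/
structure IsEuclideanNormalization {n : ℕ} (U : Set (E n)) (x ξ : E n → E (n + 1)) :
    Prop where
  contDiffOn : ContDiffOn ℝ 1 ξ U
  norm_eq_one : ∀ u ∈ U, ‖ξ u‖ = 1
  orthogonal : ∀ u ∈ U, ∀ i : Fin n, inner ℝ (ξ u) (pd i x u) = 0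

/-- `y` is a relative normalization of class `C¹`: it is nowhere tangent, and its partial
derivatives are everywhere tangent. -/
structure IsRelativeNormalization {n : ℕ} (U : Set (E n)) (x y : E n → E (n + 1)) :
    Prop where
  contDiffOn : ContDiffOn ℝ 1 y U
  not_mem_tangentSpace : ∀ u ∈ U, y u ∉ tangentSpace x u
  pd_mem_tangentSpace : ∀ u ∈ U, ∀ i : Fin n, pd i y u ∈ tangentSpace x u

/-- First fundamental form `g_{ij} = ⟨x_{/i}, x_{/j}⟩`. -/
def firstForm {n : ℕ} (x : E n → E (n + 1)) (u : E n) : Matrix (Fin n) (Fin n) ℝ :=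
  Matrix.of fun i j => inner ℝ (pd i x u) (pd j x u)

/-- Second fundamental form `h_{ij} = ⟨ξ, x_{/ij}⟩`. -/
def secondForm {n : ℕ} (x ξ : E n → E (n + 1)) (u : E n) : Matrix (Fin n) (Fin n) ℝ :=
  Matrix.of fun i j => inner ℝ (ξ u) (pd2 i j x u)

/-- Gaussian (Gauss–Kronecker) curvature `K = det (h_{ij}) / det (g_{ij})`. -/
def gaussCurvature {n : ℕ} (x ξ : E n → E (n + 1)) (u : E n) : ℝ :=
  (secondForm x ξ u).det / (firstForm x u).det

/-- Support function `q = ⟨ξ, y⟩`. -/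
def supportFunction {n : ℕ} (ξ y : E n → E (n + 1)) (u : E n) : ℝ :=
  inner ℝ (ξ u) (y u)

/-- The covector `X = q⁻¹ ξ` of the tangent hyperplane. By `covector_spec` below it is the
unique vector with `⟨X, x_{/i}⟩ = 0` for all `i` and `⟨X, y⟩ = 1`. -/
def covector {n : ℕ} (ξ y : E n → E (n + 1)) (u : E n) : E (n + 1) :=
  (supportFunction ξ y u)⁻¹ • ξ u

/-- The relative metric `G_{ij} = ⟨X, x_{/ij}⟩`. -/
def relativeMetric {n : ℕ} (x ξ y : E n → E (n + 1)) (u : E n) :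
    Matrix (Fin n) (Fin n) ℝ :=
  Matrix.of fun i j => inner ℝ (covector ξ y u) (pd2 i j x u)

/-- Christoffel symbols `Γᵏ_{ij}` of the Levi-Civita connection of a (pseudo-)Riemannian
metric `G` given in coordinates. -/
def christoffel {n : ℕ} (G : E n → Matrix (Fin n) (Fin n) ℝ) (k i j : Fin n) (u : E n) : ℝ :=
  (1 / 2) * ∑ m : Fin n, (G u)⁻¹ k m *
    (pd i (fun w => G w j m) u + pd j (fun w => G w i m) u - pd m (fun w => G w i j) u)

/-- Second Beltrami differential operator
`Δᴳ f = Gⁱʲ ∇_i ∇_j f = Gⁱʲ (f_{/ij} - Γᵏ_{ij} f_{/k})`, applied componentwise to vector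
valued maps. -/
def beltrami {n : ℕ} {F : Type*} [NormedAddCommGroup F] [NormedSpace ℝ F]
    (G : E n → Matrix (Fin n) (Fin n) ℝ) (f : E n → F) (u : E n) : F :=
  ∑ i : Fin n, ∑ j : Fin n, (G u)⁻¹ i j •
    (pd2 i j f u - ∑ k : Fin n, christoffel G k i j u • pd k f u)

theorem mem_tangentSpace_iff {n : ℕ} {U : Set (E n)} {x ξ : E n → E (n + 1)}
    (hx : IsInjectiveImmersion U x) (hξ : IsEuclideanNormalization U x ξ)
    {u : E n} (hu : u ∈ U) (v : E (n + 1)) :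
    v ∈ tangentSpace x u ↔ inner ℝ (ξ u) v = 0 := by
  have hne : ξ u ≠ 0 := by
    intro h
    have := hξ.norm_eq_one u hu
    simp [h] at this
  have hle : tangentSpace x u ≤ (ℝ ∙ ξ u)ᗮ := by
    refine Submodule.span_le.2 ?_
    rintro _ ⟨i, rfl⟩
    exact Submodule.mem_orthogonal_singleton_iff_inner_right.2 (hξ.orthogonal u hu i)
  have h1 : Module.finrank ℝ (tangentSpace x u) = n := by
    exact (finrank_span_eq_card (hx.linearIndependent u hu)).trans (Fintype.card_fin n)
  have h2 : Module.finrank ℝ ((ℝ ∙ ξ u)ᗮ : Submodule ℝ (E (n + 1))) = n := by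
    have : Fact (Module.finrank ℝ (E (n + 1)) = n + 1) := ⟨by simp⟩
    exact Submodule.finrank_orthogonal_span_singleton hne
  have heq := Submodule.eq_of_le_of_finrank_eq hle (h1.trans h2.symm)
  rw [heq]
  exact Submodule.mem_orthogonal_singleton_iff_inner_right

theorem supportFunction_ne_zero {n : ℕ} {U : Set (E n)} {x ξ y : E n → E (n + 1)}
    (hx : IsInjectiveImmersion U x) (hξ : IsEuclideanNormalization U x ξ)
    (hy : IsRelativeNormalization U x y) {u : E n} (hu : u ∈ U) :
    supportFunction ξ y u ≠ 0 := fun h =>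
  hy.not_mem_tangentSpace u hu ((mem_tangentSpace_iff hx hξ hu _).2 h)

theorem covector_spec {n : ℕ} {U : Set (E n)} {x ξ y : E n → E (n + 1)}
    (hx : IsInjectiveImmersion U x) (hξ : IsEuclideanNormalization U x ξ)
    (hy : IsRelativeNormalization U x y) {u : E n} (hu : u ∈ U) (X : E (n + 1)) :
    ((∀ i : Fin n, inner ℝ X (pd i x u) = 0) ∧ inner ℝ X (y u) = 1) ↔
      X = covector ξ y u := by
  have hq := supportFunction_ne_zero hx hξ hy hu
  constructor
  · rintro ⟨h1, h2⟩
    have hX : ∀ v ∈ tangentSpace x u, inner ℝ X v = 0 := by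
      intro v hv
      have hle : tangentSpace x u ≤ (ℝ ∙ X)ᗮ := by
        refine Submodule.span_le.2 ?_
        rintro _ ⟨i, rfl⟩
        exact Submodule.mem_orthogonal_singleton_iff_inner_right.2 (h1 i)
      exact Submodule.mem_orthogonal_singleton_iff_inner_right.1 (hle hv)
    have hq' : inner ℝ (ξ u) (y u) ≠ 0 := hq
    refine ext_inner_right ℝ fun v => ?_
    have hv : v - (inner ℝ (ξ u) v / inner ℝ (ξ u) (y u)) • y u ∈ tangentSpace x u := by
      rw [mem_tangentSpace_iff hx hξ hu, inner_sub_right, inner_smul_right]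
      field_simp
      ring
    have h3 := hX _ hv
    rw [inner_sub_right, inner_smul_right, h2] at h3
    rw [covector, supportFunction, real_inner_smul_left]
    field_simp at h3 ⊢
    linarith
  · rintro rfl
    refine ⟨fun i => ?_, ?_⟩
    · rw [covector, real_inner_smul_left, hξ.orthogonal u hu i, mul_zero]
    · rw [covector, real_inner_smul_left]
      exact inv_mul_cancel₀ hq

end RelGeom

end

/-!
The relative metric is conformal to the second fundamental form, `h = q G`, so its inverse and
Christoffel symbols can be written through `h`, its first derivatives and `dq`. Write `T_l` for
`⟨Δᴳx, ξ_{/l}⟩`. Weingarten's equation `⟨ξ_{/l}, x_{/k}⟩ = -h_{lk}` turns the Christoffel term of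
`T_l` into the lowered Christoffel symbols of `G`, and the Codazzi equation trades
`⟨x_{/ij}, ξ_{/l}⟩` for `⟨x_{/jl}, ξ_{/i}⟩`, whose contraction with `h^{ij}` is
`-½ g^{ij} g_{ij/l}`. What remains is
`T_l = (q/2) (h^{ij} h_{ij/l} - g^{ij} g_{ij/l}) + ((n-2)/2) q_{/l}`
(`inner_beltrami_pd_normal_eq_trace`). By Jacobi's formula (`pd_det`) the bracket is the
logarithmic derivative of `K = det h / det g`, hence
`2 K T_l = q K_{/l} + (n-2) K q_{/l}` (`gaussCurvature_mul_inner_beltrami`).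

Up to a factor without zeros the right-hand side is the `l`-th partial derivative of `K q^{n-2}`.
On a connected domain, `T` therefore vanishes if and only if `K q^{n-2}` is constant
(`inner_beltrami_fderiv_eq_zero_iff`). For `n = 2` this function is `K`; for `n ≥ 3` the constancy
is solved for `q` in `exists_mul_pow_eq_iff`, using that `K` and `q` do not change sign.
-/

namespace RelGeom

open Matrix

/-! ### Partial derivatives and Jacobi's formula -/

section PartialDerivatives

variable {n : ℕ} {F : Type*} [NormedAddCommGroup F] [NormedSpace ℝ F]

theorem fderiv_apply_eq_sum_pd (f : E n → F) (u v : E n) :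
    fderiv ℝ f u v = ∑ i : Fin n, v i • pd i f u := by
  have hv : v = ∑ i : Fin n, v i • EuclideanSpace.single i (1 : ℝ) := by
    have := (EuclideanSpace.basisFun (Fin n) ℝ).sum_repr v
    simpa using this.symm
  conv_lhs => rw [hv, map_sum]
  simp only [map_smul, pd]

theorem fderiv_eq_zero_iff_pd (f : E n → F) (u : E n) :
    fderiv ℝ f u = 0 ↔ ∀ i : Fin n, pd i f u = 0 := by
  constructor
  · intro h i
    simp [pd, h]
  · intro h
    ext v
    simp [fderiv_apply_eq_sum_pd, h]

theorem pd_congr_of_eqOn {U : Set (E n)} (hU : IsOpen U) {f g : E n → F} (h : Set.EqOn f g U)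
    {u : E n} (hu : u ∈ U) (i : Fin n) : pd i f u = pd i g u := by
  have : f =ᶠ[nhds u] g := h.eventuallyEq_of_mem (hU.mem_nhds hu)
  rw [pd, pd, this.fderiv_eq]

theorem pd_const (c : F) (u : E n) (i : Fin n) : pd i (fun _ => c) u = 0 := by
  simp [pd]

theorem pd_mul {f g : E n → ℝ} {u : E n} (hf : DifferentiableAt ℝ f u)
    (hg : DifferentiableAt ℝ g u) (i : Fin n) :
    pd i (fun w => f w * g w) u = pd i f u * g u + f u * pd i g u := by
  simp only [pd, fderiv_fun_mul hf hg, _root_.add_apply,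
    _root_.smul_apply, smul_eq_mul]
  ring

theorem pd_pow {f : E n → ℝ} {u : E n} (hf : DifferentiableAt ℝ f u) (m : ℕ) (i : Fin n) :
    pd i (fun w => f w ^ m) u = m * f u ^ (m - 1) * pd i f u := by
  simp only [pd, fderiv_fun_pow m hf, _root_.smul_apply, smul_eq_mul,
    nsmul_eq_mul]

theorem pd_inv {f : E n → ℝ} {u : E n} (hf : DifferentiableAt ℝ f u) (h0 : f u ≠ 0)
    (i : Fin n) : pd i (fun w => (f w)⁻¹) u = -pd i f u / f u ^ 2 := by
  have := ((hasDerivAt_inv h0).comp_hasFDerivAt u hf.hasFDerivAt).fderiv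
  rw [Function.comp_def] at this
  simp only [pd, this, _root_.smul_apply, smul_eq_mul]
  ring

theorem pd_inner {m : ℕ} {f g : E n → E m} {u : E n} (hf : DifferentiableAt ℝ f u)
    (hg : DifferentiableAt ℝ g u) (i : Fin n) :
    pd i (fun w => (inner ℝ (f w) (g w) : ℝ)) u =
      inner ℝ (pd i f u) (g u) + inner ℝ (f u) (pd i g u) := by
  rw [pd, fderiv_inner_apply ℝ hf hg, add_comm]
  rfl

theorem contDiffOn_pd {U : Set (E n)} (hU : IsOpen U) {f : E n → F} {k m : WithTop ℕ∞}
    (hf : ContDiffOn ℝ k f U) (hm : m + 1 ≤ k) (i : Fin n) : ContDiffOn ℝ m (pd i f) U :=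
  (hf.fderiv_of_isOpen hU hm).clm_apply contDiffOn_const

/-- Schwarz's theorem: mixed second partial derivatives commute. -/
theorem pd2_comm {U : Set (E n)} (hU : IsOpen U) {f : E n → F} (hf : ContDiffOn ℝ 2 f U)
    {u : E n} (hu : u ∈ U) (i j : Fin n) : pd2 i j f u = pd2 j i f u := by
  have hd : DifferentiableAt ℝ (fderiv ℝ f) u :=
    ((hf.fderiv_of_isOpen hU (m := 1) (by norm_num)).differentiableOn
      (by norm_num)).differentiableAt (hU.mem_nhds hu)
  have key : ∀ a b : Fin n, pd2 a b f u =
      fderiv ℝ (fderiv ℝ f) u (EuclideanSpace.single b 1) (EuclideanSpace.single a 1) := by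
    intro a b
    have : HasFDerivAt (fun w => fderiv ℝ f w (EuclideanSpace.single a 1))
        ((fderiv ℝ (fderiv ℝ f) u).flip (EuclideanSpace.single a 1)) u := by
      simpa using hd.hasFDerivAt.clm_apply (hasFDerivAt_const (EuclideanSpace.single a 1) u)
    exact congrArg (fun L => L (EuclideanSpace.single b 1)) this.fderiv
  rw [key, key]
  exact (hf.contDiffAt (hU.mem_nhds hu)).isSymmSndFDerivAt (by simp) _ _

theorem differentiableAt_det {m : Type*} [Fintype m] [DecidableEq m] {A : E n → Matrix m m ℝ}
    {u : E n} (hA : ∀ i j, DifferentiableAt ℝ (fun w => A w i j) u) :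
    DifferentiableAt ℝ (fun w => (A w).det) u := by
  simp only [det_apply']
  refine DifferentiableAt.fun_sum fun σ _ => DifferentiableAt.const_mul ?_ _
  exact (HasFDerivAt.finsetProd fun i _ => (hA (σ i) i).hasFDerivAt).differentiableAt

/-- Jacobi's formula for the derivative of a determinant. -/
theorem pd_det {m : Type*} [Fintype m] [DecidableEq m] {A : E n → Matrix m m ℝ} {u : E n}
    (hA : ∀ i j, DifferentiableAt ℝ (fun w => A w i j) u) (l : Fin n) :
    pd l (fun w => (A w).det) u =
      trace (adjugate (A u) * of fun i j => pd l (fun w => A w i j) u) := by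
  have h1 : HasFDerivAt (fun w => (A w).det) (∑ σ : Equiv.Perm m,
      ((Equiv.Perm.sign σ : ℤ) : ℝ) • ∑ i, (∏ j ∈ Finset.univ.erase i, A u (σ j) j) •
        fderiv ℝ (fun w => A w (σ i) i) u) u := by
    simp only [det_apply']
    refine HasFDerivAt.fun_sum fun σ _ => ?_
    refine HasFDerivAt.const_mul ?_ _
    exact HasFDerivAt.finsetProd fun i _ => (hA (σ i) i).hasFDerivAt
  have h2 : ∀ i, (adjugate (A u) * of fun i j => pd l (fun w => A w i j) u) i i =
      ((A u).updateCol i fun k => pd l (fun w => A w k i) u).det := by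
    intro i
    rw [← cramer_apply, cramer_eq_adjugate_mulVec]
    rfl
  rw [pd, h1.fderiv, trace]
  simp only [diag_apply, h2, det_apply', _root_.sum_apply,
    _root_.smul_apply, smul_eq_mul]
  rw [Finset.sum_comm]
  refine Finset.sum_congr rfl fun σ _ => ?_
  rw [← Finset.mul_sum]
  congr 1
  refine Finset.sum_congr rfl fun i _ => ?_
  rw [← Finset.mul_prod_erase _ _ (Finset.mem_univ i), updateCol_self, mul_comm]
  congr 1
  refine Finset.prod_congr rfl fun j hj => ?_
  rw [updateCol_ne (Finset.ne_of_mem_erase hj)]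

theorem pd_det_of_det_ne_zero {m : Type*} [Fintype m] [DecidableEq m]
    {A : E n → Matrix m m ℝ} {u : E n}
    (hA : ∀ i j, DifferentiableAt ℝ (fun w => A w i j) u) (h0 : (A u).det ≠ 0) (l : Fin n) :
    pd l (fun w => (A w).det) u =
      (A u).det * trace ((A u)⁻¹ * of fun i j => pd l (fun w => A w i j) u) := by
  rw [pd_det hA, inv_def, Ring.inverse_eq_inv', smul_mul, trace_smul, smul_eq_mul,
    mul_inv_cancel_left₀ h0]

end PartialDerivatives

/-! ### Regularity and symmetry of the fundamental forms -/

section Regularity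

variable {n : ℕ} {U : Set (E n)} {x ξ y : E n → E (n + 1)}

theorem contDiffOn_pd2 (hU : IsOpen U) (hx : IsInjectiveImmersion U x) (i j : Fin n) :
    ContDiffOn ℝ 1 (pd2 i j x) U :=
  contDiffOn_pd hU (contDiffOn_pd hU (m := 2) hx.contDiffOn (by norm_num) i) (by norm_num) j

theorem contDiffOn_firstForm (hU : IsOpen U) (hx : IsInjectiveImmersion U x) (i j : Fin n) :
    ContDiffOn ℝ 1 (fun w => firstForm x w i j) U :=
  (contDiffOn_pd hU hx.contDiffOn (by norm_num) i).inner ℝ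
    (contDiffOn_pd hU hx.contDiffOn (by norm_num) j)

theorem contDiffOn_secondForm (hU : IsOpen U) (hx : IsInjectiveImmersion U x)
    (hξ : IsEuclideanNormalization U x ξ) (i j : Fin n) :
    ContDiffOn ℝ 1 (fun w => secondForm x ξ w i j) U :=
  hξ.contDiffOn.inner ℝ (contDiffOn_pd2 hU hx i j)

theorem contDiffOn_supportFunction (hξ : IsEuclideanNormalization U x ξ)
    (hy : IsRelativeNormalization U x y) : ContDiffOn ℝ 1 (supportFunction ξ y) U :=
  hξ.contDiffOn.inner ℝ hy.contDiffOn

theorem secondForm_comm (hU : IsOpen U) (hx : IsInjectiveImmersion U x) {u : E n} (hu : u ∈ U)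
    (i j : Fin n) : secondForm x ξ u i j = secondForm x ξ u j i := by
  simp only [secondForm, of_apply]
  rw [pd2_comm hU (hx.contDiffOn.of_le (by norm_num)) hu]

theorem firstForm_comm (u : E n) (i j : Fin n) : firstForm x u i j = firstForm x u j i := by
  simp only [firstForm, of_apply]
  exact real_inner_comm _ _

theorem det_secondForm_ne_zero {u : E n} (hK : gaussCurvature x ξ u ≠ 0) :
    (secondForm x ξ u).det ≠ 0 := fun h => hK (by simp [gaussCurvature, h])

theorem det_firstForm_ne_zero {u : E n} (hx : IsInjectiveImmersion U x) (hu : u ∈ U) :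
    (firstForm x u).det ≠ 0 := by
  have h : firstForm x u = gram ℝ (fun i => pd i x u) := by
    ext i j
    simp [firstForm, gram_apply]
  rw [h]
  exact (posDef_gram_of_linearIndependent (hx.linearIndependent u hu)).det_pos.ne'

end Regularity

/-! ### The equations of Weingarten and Codazzi; the relative metric -/

section StructureEquations

variable {n : ℕ} {U : Set (E n)} {x ξ y : E n → E (n + 1)}

/-- Weingarten's equation `⟨ξ_{/i}, x_{/j}⟩ = -h_{ij}`. -/
theorem inner_pd_normal_pd (hU : IsOpen U) (hx : IsInjectiveImmersion U x)
    (hξ : IsEuclideanNormalization U x ξ) {u : E n} (hu : u ∈ U) (i j : Fin n) :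
    inner ℝ (pd i ξ u) (pd j x u) = -secondForm x ξ u i j := by
  have h0 := pd_congr_of_eqOn hU (fun w hw => hξ.orthogonal w hw j) hu i
  rw [pd_const, pd_inner
    ((hξ.contDiffOn.differentiableOn (by norm_num)).differentiableAt (hU.mem_nhds hu))
    (((contDiffOn_pd hU (m := 2) hx.contDiffOn (by norm_num) j).differentiableOn
      (by norm_num)).differentiableAt (hU.mem_nhds hu))] at h0
  rw [secondForm_comm hU hx hu i j]
  exact eq_neg_of_add_eq_zero_left h0

theorem inner_normal_pd_normal (hU : IsOpen U) (hξ : IsEuclideanNormalization U x ξ)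
    {u : E n} (hu : u ∈ U) (i : Fin n) : inner ℝ (ξ u) (pd i ξ u) = (0 : ℝ) := by
  have hd := (hξ.contDiffOn.differentiableOn (by norm_num)).differentiableAt (hU.mem_nhds hu)
  have h1 : Set.EqOn (fun w => (inner ℝ (ξ w) (ξ w) : ℝ)) (fun _ => 1) U := fun w hw => by
    simp [hξ.norm_eq_one w hw]
  have h0 := pd_congr_of_eqOn hU h1 hu i
  rw [pd_const, pd_inner hd hd, real_inner_comm] at h0
  linarith

/-- Weingarten's equation solved for the derivative of the normal:
`ξ_{/i} = -h_{ip} g^{pk} x_{/k}`. -/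
theorem pd_normal_eq (hU : IsOpen U) (hx : IsInjectiveImmersion U x)
    (hξ : IsEuclideanNormalization U x ξ) {u : E n} (hu : u ∈ U) (i : Fin n) :
    pd i ξ u = -∑ k, (secondForm x ξ u * (firstForm x u)⁻¹) i k • pd k x u := by
  have hmem := (mem_tangentSpace_iff hx hξ hu _).2 (inner_normal_pd_normal hU hξ hu i)
  obtain ⟨c, hc⟩ := (Submodule.mem_span_range_iff_exists_fun ℝ).1 hmem
  have h1 : c ᵥ* firstForm x u = -(secondForm x ξ u) i := by
    ext j
    rw [Pi.neg_apply, ← inner_pd_normal_pd hU hx hξ hu, ← hc, sum_inner]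
    simp only [real_inner_smul_left]
    rfl
  have h2 : c = -((secondForm x ξ u * (firstForm x u)⁻¹) i) := by
    have hg : IsUnit (firstForm x u).det := (det_firstForm_ne_zero hx hu).isUnit
    calc c = c ᵥ* (firstForm x u * (firstForm x u)⁻¹) := by
          rw [mul_nonsing_inv _ hg, vecMul_one]
      _ = -((secondForm x ξ u) i ᵥ* (firstForm x u)⁻¹) := by
          rw [← vecMul_vecMul, h1, neg_vecMul]
      _ = _ := rfl
  rw [← hc, h2]
  simp

theorem pd_secondForm (hU : IsOpen U) (hx : IsInjectiveImmersion U x)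
    (hξ : IsEuclideanNormalization U x ξ) {u : E n} (hu : u ∈ U) (i j l : Fin n) :
    pd l (fun w => secondForm x ξ w i j) u =
      inner ℝ (pd2 i j x u) (pd l ξ u) + inner ℝ (ξ u) (pd l (pd2 i j x) u) := by
  rw [real_inner_comm (pd l ξ u)]
  exact pd_inner ((hξ.contDiffOn.differentiableOn (by norm_num)).differentiableAt
    (hU.mem_nhds hu)) (((contDiffOn_pd2 hU hx i j).differentiableOn (by norm_num)).differentiableAt
    (hU.mem_nhds hu)) l

/-- The Codazzi equation, in the form
`⟨x_{/ij}, ξ_{/l}⟩ + h_{jl/i} = ⟨x_{/jl}, ξ_{/i}⟩ + h_{ij/l}`. -/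
theorem codazzi (hU : IsOpen U) (hx : IsInjectiveImmersion U x)
    (hξ : IsEuclideanNormalization U x ξ) {u : E n} (hu : u ∈ U) (i j l : Fin n) :
    inner ℝ (pd2 i j x u) (pd l ξ u) + pd i (fun w => secondForm x ξ w j l) u =
      inner ℝ (pd2 j l x u) (pd i ξ u) + pd l (fun w => secondForm x ξ w i j) u := by
  have hx2 : ContDiffOn ℝ 2 x U := hx.contDiffOn.of_le (by norm_num)
  have hj : ContDiffOn ℝ 2 (pd j x) U := contDiffOn_pd hU hx.contDiffOn (by norm_num) j
  have h3 : pd l (pd2 i j x) u = pd i (pd2 j l x) u := by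
    rw [pd_congr_of_eqOn hU (fun w hw => pd2_comm hU hx2 hw i j) hu l]
    exact pd2_comm hU hj hu i l
  rw [pd_secondForm hU hx hξ hu, pd_secondForm hU hx hξ hu, h3]
  ring

theorem pd_firstForm (hU : IsOpen U) (hx : IsInjectiveImmersion U x) {u : E n} (hu : u ∈ U)
    (i j l : Fin n) :
    pd l (fun w => firstForm x w i j) u =
      inner ℝ (pd2 i l x u) (pd j x u) + inner ℝ (pd2 j l x u) (pd i x u) := by
  have hd : ∀ k, DifferentiableAt ℝ (pd k x) u := fun k =>
    ((contDiffOn_pd hU (m := 2) hx.contDiffOn (by norm_num) k).differentiableOn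
      (by norm_num)).differentiableAt (hU.mem_nhds hu)
  rw [real_inner_comm (pd i x u)]
  exact pd_inner (hd i) (hd j) l

theorem relativeMetric_eq_smul (x ξ y : E n → E (n + 1)) (u : E n) :
    relativeMetric x ξ y u = (supportFunction ξ y u)⁻¹ • secondForm x ξ u := by
  ext i j
  simp only [relativeMetric, covector, secondForm, of_apply, real_inner_smul_left, Matrix.smul_apply,
    smul_eq_mul]

theorem pd_relativeMetric (hU : IsOpen U) (hx : IsInjectiveImmersion U x)
    (hξ : IsEuclideanNormalization U x ξ) (hy : IsRelativeNormalization U x y)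
    {u : E n} (hu : u ∈ U) (i j l : Fin n) :
    pd l (fun w => relativeMetric x ξ y w i j) u =
      (supportFunction ξ y u)⁻¹ * pd l (fun w => secondForm x ξ w i j) u -
        pd l (supportFunction ξ y) u / supportFunction ξ y u ^ 2 * secondForm x ξ u i j := by
  have hq := supportFunction_ne_zero hx hξ hy hu
  have hqd := ((contDiffOn_supportFunction hξ hy).differentiableOn
    (by norm_num)).differentiableAt (hU.mem_nhds hu)
  have hhd := ((contDiffOn_secondForm hU hx hξ i j).differentiableOn
    (by norm_num)).differentiableAt (hU.mem_nhds hu)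
  have h : (fun w => relativeMetric x ξ y w i j) =
      fun w => (supportFunction ξ y w)⁻¹ * secondForm x ξ w i j := by
    funext w
    rw [relativeMetric_eq_smul, Matrix.smul_apply, smul_eq_mul]
  rw [h, pd_mul (f := fun w => (supportFunction ξ y w)⁻¹) (hqd.fun_inv hq) hhd, pd_inv hqd hq]
  ring

theorem relativeMetric_inv {u : E n} (hq : supportFunction ξ y u ≠ 0)
    (hh : (secondForm x ξ u).det ≠ 0) :
    (relativeMetric x ξ y u)⁻¹ = supportFunction ξ y u • (secondForm x ξ u)⁻¹ := by
  refine inv_eq_right_inv ?_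
  rw [relativeMetric_eq_smul, smul_mul_smul_comm, inv_mul_cancel₀ hq,
    mul_nonsing_inv _ hh.isUnit, one_smul]

end StructureEquations

/-! ### The tangential part of the Beltrami operator -/

section BeltramiFormula

variable {n : ℕ} {U : Set (E n)} {x ξ y : E n → E (n + 1)}

/-- Lowering the upper index of the Christoffel symbols of the relative metric; the factor `q`
appears because the second fundamental form is `q` times the relative metric. -/
theorem sum_secondForm_mul_christoffel {u : E n} (hq : supportFunction ξ y u ≠ 0)
    (hh : (secondForm x ξ u).det ≠ 0) (i j l : Fin n) :
    ∑ k, secondForm x ξ u l k * christoffel (relativeMetric x ξ y) k i j u =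
      supportFunction ξ y u / 2 *
        (pd i (fun w => relativeMetric x ξ y w j l) u +
          pd j (fun w => relativeMetric x ξ y w i l) u -
          pd l (fun w => relativeMetric x ξ y w i j) u) := by
  set M : Fin n → ℝ := fun m => pd i (fun w => relativeMetric x ξ y w j m) u +
          pd j (fun w => relativeMetric x ξ y w i m) u -
          pd m (fun w => relativeMetric x ξ y w i j) u with hM
  have h1 : ∀ k, christoffel (relativeMetric x ξ y) k i j u =
      ((1 / 2 : ℝ) • ((relativeMetric x ξ y u)⁻¹ *ᵥ M)) k := fun k => rfl
  have h2 : ∑ k, secondForm x ξ u l k * christoffel (relativeMetric x ξ y) k i j u =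
      (secondForm x ξ u *ᵥ ((1 / 2 : ℝ) • ((relativeMetric x ξ y u)⁻¹ *ᵥ M))) l := by
    simp only [h1]
    rfl
  rw [h2, mulVec_smul, mulVec_mulVec, relativeMetric_inv hq hh, Matrix.mul_smul,
    mul_nonsing_inv _ hh.isUnit, smul_mulVec, one_mulVec]
  simp only [Pi.smul_apply, smul_eq_mul]
  ring

theorem secondForm_inv_comm (hU : IsOpen U) (hx : IsInjectiveImmersion U x) {u : E n}
    (hu : u ∈ U) (i j : Fin n) : (secondForm x ξ u)⁻¹ i j = (secondForm x ξ u)⁻¹ j i := by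
  have h : (secondForm x ξ u)ᵀ = secondForm x ξ u := by
    ext a b
    exact secondForm_comm hU hx hu b a
  conv_lhs => rw [← h, ← transpose_nonsing_inv]
  rfl

theorem inner_beltrami_pd_normal_eq_sum (hU : IsOpen U) (hx : IsInjectiveImmersion U x)
    (hξ : IsEuclideanNormalization U x ξ) (hy : IsRelativeNormalization U x y)
    {u : E n} (hu : u ∈ U) (hh : (secondForm x ξ u).det ≠ 0) (l : Fin n) :
    inner ℝ (beltrami (relativeMetric x ξ y) x u) (pd l ξ u) =
      ∑ i, ∑ j, supportFunction ξ y u * (secondForm x ξ u)⁻¹ i j *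
        (inner ℝ (pd2 i j x u) (pd l ξ u) + supportFunction ξ y u / 2 *
          (pd i (fun w => relativeMetric x ξ y w j l) u +
            pd j (fun w => relativeMetric x ξ y w i l) u -
            pd l (fun w => relativeMetric x ξ y w i j) u)) := by
  have hq := supportFunction_ne_zero hx hξ hy hu
  rw [beltrami, sum_inner]
  refine Finset.sum_congr rfl fun i _ => ?_
  rw [sum_inner]
  refine Finset.sum_congr rfl fun j _ => ?_
  rw [real_inner_smul_left, relativeMetric_inv hq hh, Matrix.smul_apply, smul_eq_mul, inner_sub_left,
    sum_inner, ← sum_secondForm_mul_christoffel hq hh, sub_eq_add_neg, ← Finset.sum_neg_distrib]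
  congr 2
  refine Finset.sum_congr rfl fun k _ => ?_
  rw [real_inner_smul_left, real_inner_comm, inner_pd_normal_pd hU hx hξ hu]
  ring

/-- Contracting `⟨x_{/jl}, ξ_{/i}⟩` with `h^{ij}` gives `-½ ∂_l log det g`. -/
theorem sum_secondForm_inv_mul_inner (hU : IsOpen U) (hx : IsInjectiveImmersion U x)
    (hξ : IsEuclideanNormalization U x ξ) {u : E n} (hu : u ∈ U)
    (hh : (secondForm x ξ u).det ≠ 0) (l : Fin n) :
    ∑ i, ∑ j, (secondForm x ξ u)⁻¹ i j * inner ℝ (pd2 j l x u) (pd i ξ u) =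
      -(1 / 2) * trace ((firstForm x u)⁻¹ * of fun i j => pd l (fun w => firstForm x w i j) u) := by
  have hg : ∀ i j, (firstForm x u)⁻¹ i j = (firstForm x u)⁻¹ j i := fun i j => by
    have h : (firstForm x u)ᵀ = firstForm x u := by
      ext a b
      exact firstForm_comm u b a
    conv_lhs => rw [← h, ← transpose_nonsing_inv]
    rfl
  set b : Matrix (Fin n) (Fin n) ℝ := of fun k j => inner ℝ (pd2 j l x u) (pd k x u) with hb
  have h1 : ∀ i j, inner ℝ (pd2 j l x u) (pd i ξ u) =
      -((secondForm x ξ u * (firstForm x u)⁻¹) * b) i j := by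
    intro i j
    rw [pd_normal_eq hU hx hξ hu, inner_neg_right, inner_sum, mul_apply]
    simp only [real_inner_smul_right, hb, of_apply]
  have h2 : ∑ i, ∑ j, (secondForm x ξ u)⁻¹ i j * inner ℝ (pd2 j l x u) (pd i ξ u) =
      -trace ((secondForm x ξ u)⁻¹ * ((secondForm x ξ u * (firstForm x u)⁻¹) * b)) := by
    rw [trace, Finset.sum_comm, ← Finset.sum_neg_distrib]
    refine Finset.sum_congr rfl fun j _ => ?_
    rw [diag_apply, mul_apply, ← Finset.sum_neg_distrib]
    refine Finset.sum_congr rfl fun i _ => ?_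
    rw [h1, secondForm_inv_comm hU hx hu]
    ring
  have h3 : (of fun i j => pd l (fun w => firstForm x w i j) u) = b + bᵀ := by
    ext i j
    simp only [of_apply, Matrix.add_apply, transpose_apply, hb]
    rw [pd_firstForm hU hx hu]
    ring
  have h4 : trace ((firstForm x u)⁻¹ * bᵀ) = trace ((firstForm x u)⁻¹ * b) := by
    rw [← trace_transpose, transpose_mul, transpose_transpose, trace_mul_comm]
    congr 2
    ext i j
    exact hg j i
  rw [h2, h3, Matrix.mul_add, trace_add, h4, Matrix.mul_assoc, ← Matrix.mul_assoc,
    nonsing_inv_mul _ hh.isUnit, Matrix.one_mul]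
  ring

theorem sum_secondForm_inv_mul_secondForm {u : E n} (hh : (secondForm x ξ u).det ≠ 0)
    (c : Fin n → ℝ) (l : Fin n) :
    ∑ i, ∑ j, (secondForm x ξ u)⁻¹ i j * (c i * secondForm x ξ u j l) = c l := by
  have h : ∀ i, ∑ j, (secondForm x ξ u)⁻¹ i j * (c i * secondForm x ξ u j l) =
      c i * (1 : Matrix (Fin n) (Fin n) ℝ) i l := by
    intro i
    rw [← nonsing_inv_mul _ hh.isUnit, mul_apply, Finset.mul_sum]
    exact Finset.sum_congr rfl fun j _ => by ring
  simp [h, one_apply]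

theorem trace_secondForm_inv_mul (hU : IsOpen U) (hx : IsInjectiveImmersion U x)
    {u : E n} (hu : u ∈ U) (A : Matrix (Fin n) (Fin n) ℝ) :
    trace ((secondForm x ξ u)⁻¹ * A) = ∑ i, ∑ j, (secondForm x ξ u)⁻¹ i j * A i j := by
  rw [trace, Finset.sum_comm]
  refine Finset.sum_congr rfl fun j _ => ?_
  rw [diag_apply, mul_apply]
  refine Finset.sum_congr rfl fun i _ => ?_
  rw [secondForm_inv_comm hU hx hu]

/-- The trace form of the key identity:
`⟨Δᴳx, ξ_{/l}⟩ = (q/2) (h^{ij} h_{ij/l} - g^{ij} g_{ij/l}) + ((n-2)/2) q_{/l}`. -/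
theorem inner_beltrami_pd_normal_eq_trace (hU : IsOpen U) (hx : IsInjectiveImmersion U x)
    (hξ : IsEuclideanNormalization U x ξ) (hy : IsRelativeNormalization U x y)
    {u : E n} (hu : u ∈ U) (hh : (secondForm x ξ u).det ≠ 0) (l : Fin n) :
    inner ℝ (beltrami (relativeMetric x ξ y) x u) (pd l ξ u) =
      supportFunction ξ y u / 2 *
        (trace ((secondForm x ξ u)⁻¹ * of fun i j => pd l (fun w => secondForm x ξ w i j) u) -
          trace ((firstForm x u)⁻¹ * of fun i j => pd l (fun w => firstForm x w i j) u)) +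
        ((n : ℝ) - 2) / 2 * pd l (supportFunction ξ y) u := by
  have hq := supportFunction_ne_zero hx hξ hy hu
  -- In the notation below `a i j m = ⟨x_{/ij}, ξ_{/m}⟩`, `d i j m = h_{ij/m}`, `p i = q_{/i}`.
  set q := supportFunction ξ y u with hqdef
  set H := secondForm x ξ u with hH
  set a : Fin n → Fin n → Fin n → ℝ := fun i j m => inner ℝ (pd2 i j x u) (pd m ξ u) with ha
  set d : Fin n → Fin n → Fin n → ℝ := fun i j m => pd m (fun w => secondForm x ξ w i j) u with hd
  set p : Fin n → ℝ := fun i => pd i (supportFunction ξ y) u with hp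
  have hcod : ∀ i j, a i j l + d j l i = a j l i + d i j l := fun i j => codazzi hU hx hξ hu i j l
  have ha_comm : ∀ i j, a i j l = a j i l := fun i j => by
    simp only [ha, pd2_comm hU (hx.contDiffOn.of_le (by norm_num)) hu i j]
  have hd_comm : ∀ i j, d i j l = d j i l := fun i j => by
    simp only [hd]
    exact pd_congr_of_eqOn hU (fun w hw => secondForm_comm hU hx hw i j) hu l
  have swap : ∀ f : Fin n → Fin n → ℝ,
      ∑ i, ∑ j, H⁻¹ i j * f j i = ∑ i, ∑ j, H⁻¹ i j * f i j := by
    intro f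
    rw [Finset.sum_comm]
    exact Finset.sum_congr rfl fun i _ => Finset.sum_congr rfl fun j _ => by
      rw [hH, secondForm_inv_comm hU hx hu]
  have hs1 : ∑ i, ∑ j, H⁻¹ i j * a j l i = _ := sum_secondForm_inv_mul_inner hU hx hξ hu hh l
  have hs2 : ∑ i, ∑ j, H⁻¹ i j * (p i * H j l) = p l :=
    sum_secondForm_inv_mul_secondForm hh p l
  have hs3 : ∑ i, ∑ j, H⁻¹ i j * d i j l = _ :=
    (trace_secondForm_inv_mul hU hx hu (of fun i j => d i j l)).symm
  have hs4 : ∑ i, ∑ j, H⁻¹ i j * H i j = n := by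
    rw [hH, ← trace_secondForm_inv_mul hU hx hu, nonsing_inv_mul _ hh.isUnit, trace_one,
      Fintype.card_fin]
  -- The Codazzi equation is used twice, for `(i, j)` and for `(j, i)`.
  have hterm : ∀ i j, q * H⁻¹ i j * (inner ℝ (pd2 i j x u) (pd l ξ u) + q / 2 *
          (pd i (fun w => relativeMetric x ξ y w j l) u +
            pd j (fun w => relativeMetric x ξ y w i l) u -
            pd l (fun w => relativeMetric x ξ y w i j) u)) =
      q / 2 * (H⁻¹ i j * a j l i) + q / 2 * (H⁻¹ i j * a i l j) + q / 2 * (H⁻¹ i j * d i j l)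
        - 1 / 2 * (H⁻¹ i j * (p i * H j l)) - 1 / 2 * (H⁻¹ i j * (p j * H i l))
        + p l / 2 * (H⁻¹ i j * H i j) := by
    intro i j
    have e1 := hcod i j
    have e2 := hcod j i
    rw [ha_comm j i, hd_comm j i] at e2
    simp only [pd_relativeMetric hU hx hξ hy hu]
    change q * H⁻¹ i j * (a i j l + q / 2 * (q⁻¹ * d j l i - p i / q ^ 2 * H j l +
      (q⁻¹ * d i l j - p j / q ^ 2 * H i l) - (q⁻¹ * d i j l - p l / q ^ 2 * H i j))) = _
    have e1' : d j l i = a j l i + d i j l - a i j l := by linarith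
    have e2' : d i l j = a i l j + d i j l - a i j l := by linarith
    rw [e1', e2']
    field_simp
    ring
  rw [inner_beltrami_pd_normal_eq_sum hU hx hξ hy hu hh]
  simp only [← hH, ← hqdef, hterm, Finset.sum_add_distrib, Finset.sum_sub_distrib,
    ← Finset.mul_sum]
  rw [swap fun i j => a j l i, swap fun i j => p i * H j l, hs1, hs2, hs3, hs4]
  change _ = q / 2 * (trace (H⁻¹ * of fun i j => d i j l) - _) + ((n : ℝ) - 2) / 2 * p l
  ring

theorem differentiableAt_gaussCurvature (hU : IsOpen U) (hx : IsInjectiveImmersion U x)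
    (hξ : IsEuclideanNormalization U x ξ) {u : E n} (hu : u ∈ U) :
    DifferentiableAt ℝ (gaussCurvature x ξ) u := by
  have hhd : ∀ i j, DifferentiableAt ℝ (fun w => secondForm x ξ w i j) u := fun i j =>
    ((contDiffOn_secondForm hU hx hξ i j).differentiableOn (by norm_num)).differentiableAt
      (hU.mem_nhds hu)
  have hgd : ∀ i j, DifferentiableAt ℝ (fun w => firstForm x w i j) u := fun i j =>
    ((contDiffOn_firstForm hU hx i j).differentiableOn (by norm_num)).differentiableAt
      (hU.mem_nhds hu)
  have hdh := differentiableAt_det hhd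
  have hdg := differentiableAt_det hgd
  have hdiv : gaussCurvature x ξ =
      fun w => (secondForm x ξ w).det * (firstForm x w).det⁻¹ := by
    funext w
    rw [gaussCurvature, div_eq_mul_inv]
  rw [hdiv]
  exact hdh.fun_mul (hdg.fun_inv (det_firstForm_ne_zero hx hu))

/-- Logarithmic derivative of the Gaussian curvature,
`K_{/l} = K (h^{ij} h_{ij/l} - g^{ij} g_{ij/l})`. -/
theorem pd_gaussCurvature (hU : IsOpen U) (hx : IsInjectiveImmersion U x)
    (hξ : IsEuclideanNormalization U x ξ) {u : E n} (hu : u ∈ U)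
    (hh : (secondForm x ξ u).det ≠ 0) (l : Fin n) :
    pd l (gaussCurvature x ξ) u = gaussCurvature x ξ u *
      (trace ((secondForm x ξ u)⁻¹ * of fun i j => pd l (fun w => secondForm x ξ w i j) u) -
        trace ((firstForm x u)⁻¹ * of fun i j => pd l (fun w => firstForm x w i j) u)) := by
  have hg := det_firstForm_ne_zero hx hu
  have hhd : ∀ i j, DifferentiableAt ℝ (fun w => secondForm x ξ w i j) u := fun i j =>
    ((contDiffOn_secondForm hU hx hξ i j).differentiableOn (by norm_num)).differentiableAt
      (hU.mem_nhds hu)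
  have hgd : ∀ i j, DifferentiableAt ℝ (fun w => firstForm x w i j) u := fun i j =>
    ((contDiffOn_firstForm hU hx i j).differentiableOn (by norm_num)).differentiableAt
      (hU.mem_nhds hu)
  -- Differentiating `det h = K det g` avoids a quotient rule.
  have h1 : pd l (fun w => (secondForm x ξ w).det) u =
      pd l (fun w => gaussCurvature x ξ w * (firstForm x w).det) u :=
    pd_congr_of_eqOn hU (fun w hw => by
      simp only [gaussCurvature]
      rw [div_mul_cancel₀ _ (det_firstForm_ne_zero hx hw)]) hu l
  rw [pd_mul (differentiableAt_gaussCurvature hU hx hξ hu) (differentiableAt_det hgd),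
    pd_det_of_det_ne_zero hhd hh, pd_det_of_det_ne_zero hgd hg] at h1
  have h2 : (secondForm x ξ u).det = gaussCurvature x ξ u * (firstForm x u).det := by
    rw [gaussCurvature, div_mul_cancel₀ _ hg]
  rw [h2] at h1
  apply mul_right_cancel₀ hg
  linear_combination -h1

/-- The key identity `2K ⟨Δᴳx, ξ_{/l}⟩ = q K_{/l} + (n-2) K q_{/l}`. -/
theorem gaussCurvature_mul_inner_beltrami (hU : IsOpen U) (hx : IsInjectiveImmersion U x)
    (hξ : IsEuclideanNormalization U x ξ) (hy : IsRelativeNormalization U x y)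
    {u : E n} (hu : u ∈ U) (hK : gaussCurvature x ξ u ≠ 0) (l : Fin n) :
    2 * gaussCurvature x ξ u * inner ℝ (beltrami (relativeMetric x ξ y) x u) (pd l ξ u) =
      supportFunction ξ y u * pd l (gaussCurvature x ξ) u +
        ((n : ℝ) - 2) * gaussCurvature x ξ u * pd l (supportFunction ξ y) u := by
  have hh := det_secondForm_ne_zero hK
  rw [inner_beltrami_pd_normal_eq_trace hU hx hξ hy hu hh, pd_gaussCurvature hU hx hξ hu hh]
  ring

end BeltramiFormula

/-! ### Constancy of `K q^{n-2}` -/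

section Characterization

variable {n : ℕ} {U : Set (E n)} {x ξ y : E n → E (n + 1)}

theorem forall_fderiv_iff_forall_pd (f : E n → E (n + 1)) (u : E n) (b : E (n + 1)) :
    (∀ v : E n, inner ℝ b (fderiv ℝ f u v) = (0 : ℝ)) ↔
      ∀ l : Fin n, inner ℝ b (pd l f u) = (0 : ℝ) := by
  constructor
  · exact fun h l => h _
  · intro h v
    rw [fderiv_apply_eq_sum_pd, inner_sum]
    exact Finset.sum_eq_zero fun i _ => by rw [real_inner_smul_right, h, mul_zero]

/-- A differentiable function on a connected open set is constant if and only if its partial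
derivatives vanish. -/
theorem exists_eq_const_iff_pd_eq_zero (hU : IsOpen U) (hUc : IsPreconnected U) {f : E n → ℝ}
    (hf : ∀ u ∈ U, DifferentiableAt ℝ f u) :
    (∃ c : ℝ, ∀ u ∈ U, f u = c) ↔ ∀ u ∈ U, ∀ l : Fin n, pd l f u = 0 := by
  constructor
  · rintro ⟨c, hc⟩ u hu l
    rw [pd_congr_of_eqOn hU (g := fun _ => c) hc hu, pd_const]
  · intro h
    exact hU.exists_is_const_of_fderiv_eq_zero hUc
      (fun u hu => (hf u hu).differentiableWithinAt)
      fun u hu => (fderiv_eq_zero_iff_pd f u).2 (h u hu)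

/-- `⟨Δᴳx, dξ⟩` vanishes identically if and only if `K q^{n-2}` is constant. -/
theorem inner_beltrami_fderiv_eq_zero_iff (hn : 2 ≤ n) (hU : IsOpen U) (hUc : IsPreconnected U)
    (hx : IsInjectiveImmersion U x) (hξ : IsEuclideanNormalization U x ξ)
    (hK : ∀ u ∈ U, gaussCurvature x ξ u ≠ 0) (hy : IsRelativeNormalization U x y) :
    (∀ u ∈ U, ∀ v : E n,
      inner ℝ (beltrami (relativeMetric x ξ y) x u) (fderiv ℝ ξ u v) = (0 : ℝ)) ↔
      ∃ c : ℝ, ∀ u ∈ U, gaussCurvature x ξ u * supportFunction ξ y u ^ (n - 2) = c := by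
  have hKd := fun u (hu : u ∈ U) => differentiableAt_gaussCurvature hU hx hξ hu
  have hqd := fun u (hu : u ∈ U) => ((contDiffOn_supportFunction hξ hy).differentiableOn
    (by norm_num)).differentiableAt (hU.mem_nhds hu)
  rw [exists_eq_const_iff_pd_eq_zero hU hUc fun u hu => (hKd u hu).fun_mul ((hqd u hu).fun_pow _)]
  refine forall₂_congr fun u hu => ?_
  rw [forall_fderiv_iff_forall_pd]
  refine forall_congr' fun l => ?_
  have hq := supportFunction_ne_zero hx hξ hy hu
  have key := gaussCurvature_mul_inner_beltrami hU hx hξ hy hu (hK u hu) l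
  rw [pd_mul (hKd u hu) ((hqd u hu).fun_pow _), pd_pow (hqd u hu)]
  set K := gaussCurvature x ξ u with hKdef
  set q := supportFunction ξ y u with hqdef
  -- Multiplication by `q` turns `(n - 2) q ^ (n - 3)` into `(n - 2) q ^ (n - 2)`, also for `n = 2`.
  have hpow : ((n - 2 : ℕ) : ℝ) * q ^ (n - 2 - 1) * q = ((n : ℝ) - 2) * q ^ (n - 2) := by
    rcases Nat.eq_zero_or_pos (n - 2) with h | h
    · have : n = 2 := by omega
      subst this
      simp
    · rw [mul_assoc, pow_sub_one_mul h.ne', Nat.cast_sub hn, Nat.cast_ofNat]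
  have hT : q * (pd l (gaussCurvature x ξ) u * q ^ (n - 2) +
      K * (((n - 2 : ℕ) : ℝ) * q ^ (n - 2 - 1) * pd l (supportFunction ξ y) u)) =
      q ^ (n - 2) * (2 * K) *
        inner ℝ (beltrami (relativeMetric x ξ y) x u) (pd l ξ u) := by
    linear_combination (K * pd l (supportFunction ξ y) u) * hpow - q ^ (n - 2) * key
  have hc : q ^ (n - 2) * (2 * K) ≠ 0 :=
    mul_ne_zero (pow_ne_zero _ hq) (mul_ne_zero two_ne_zero (hK u hu))
  constructor
  · intro h
    rw [h, mul_zero] at hT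
    exact (mul_eq_zero.1 hT).resolve_left hq
  · intro h
    rw [h, mul_zero] at hT
    exact (mul_eq_zero.1 hT.symm).resolve_left hc

/-- For continuous functions `k` and `q` without zeros on a preconnected set, `k q^m` is constant
if and only if `q` is a nonzero constant multiple of `|k|^{-1/m}`. The absolute value is harmless
in both directions because neither function changes sign. -/
theorem exists_mul_pow_eq_iff {X : Type*} [TopologicalSpace X] {S : Set X} (hS : IsPreconnected S)
    {k q : X → ℝ} (hkc : ContinuousOn k S) (hqc : ContinuousOn q S) (hk : ∀ u ∈ S, k u ≠ 0)
    (hq : ∀ u ∈ S, q u ≠ 0) {m : ℕ} (hm : m ≠ 0) :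
    (∃ c : ℝ, ∀ u ∈ S, k u * q u ^ m = c) ↔
      ∃ c : ℝ, c ≠ 0 ∧ ∀ u ∈ S, q u = c * |k u| ^ (-(1 / (m : ℝ))) := by
  rcases S.eq_empty_or_nonempty with rfl | ⟨p, hp⟩
  · exact ⟨fun _ => ⟨1, one_ne_zero, by simp⟩, fun _ => ⟨1, by simp⟩⟩
  -- `k` and `q` keep their signs, being continuous without zeros.
  have sign : ∀ {f : X → ℝ}, ContinuousOn f S → (∀ u ∈ S, f u ≠ 0) →
      (∀ u ∈ S, f u = |f u|) ∨ ∀ u ∈ S, f u = -|f u| := by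
    intro f hf hf0
    exact hS.eq_or_eq_neg_of_sq_eq hf hf.abs (fun u _ => by simp) fun {u} hu => by
      simpa using hf0 u hu
  have hpow : ∀ u ∈ S, (|k u| ^ (-(1 / (m : ℝ)))) ^ m = |k u|⁻¹ := fun u hu => by
    rw [← Real.rpow_natCast, ← Real.rpow_mul (abs_nonneg _),
      show -(1 / (m : ℝ)) * m = -1 by field_simp, Real.rpow_neg_one]
  constructor
  · rintro ⟨c, hc⟩
    have habs : ∀ u ∈ S, |q u| = |c| ^ (1 / (m : ℝ)) * |k u| ^ (-(1 / (m : ℝ))) := by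
      intro u hu
      refine (pow_left_inj₀ (abs_nonneg _) (by positivity) hm).1 ?_
      rw [mul_pow, hpow u hu, one_div, Real.rpow_inv_natCast_pow (abs_nonneg _) hm, ← hc u hu,
        abs_mul, abs_pow, mul_comm |k u|, mul_inv_cancel_right₀ (abs_ne_zero.2 (hk u hu))]
    have hc0 : |c| ^ (1 / (m : ℝ)) ≠ 0 := fun h => by
      have := habs p hp
      rw [h, zero_mul, abs_eq_zero] at this
      exact hq p hp this
    rcases sign hqc hq with h | h
    · exact ⟨_, hc0, fun u hu => by rw [h u hu, habs u hu]⟩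
    · exact ⟨_, neg_ne_zero.2 hc0, fun u hu => by rw [h u hu, habs u hu, neg_mul]⟩
  · rintro ⟨c, -, hc⟩
    have h1 : ∀ u ∈ S, |k u| * q u ^ m = c ^ m := fun u hu => by
      rw [hc u hu, mul_pow, hpow u hu, mul_left_comm,
        mul_inv_cancel₀ (abs_ne_zero.2 (hk u hu)), mul_one]
    rcases sign hkc hk with h | h
    · exact ⟨c ^ m, fun u hu => by rw [h u hu, h1 u hu]⟩
    · exact ⟨-c ^ m, fun u hu => by rw [h u hu, neg_mul, h1 u hu]⟩

end Characterization

end RelGeom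

theorem mainTheorem3 (n : ℕ) (U : Set (RelGeom.E n))
    (hUo : IsOpen U) (hUc : IsPreconnected U)
    (x ξ y : RelGeom.E n → RelGeom.E (n + 1))
    (hx : RelGeom.IsInjectiveImmersion U x)
    (hξ : RelGeom.IsEuclideanNormalization U x ξ)
    (hK : ∀ u ∈ U, RelGeom.gaussCurvature x ξ u ≠ 0)
    (hy : RelGeom.IsRelativeNormalization U x y) :
    (n = 2 →
      ((∀ u ∈ U, ∀ v : RelGeom.E n,
          inner ℝ (RelGeom.beltrami (RelGeom.relativeMetric x ξ y) x u)
            (fderiv ℝ ξ u v) = 0) ↔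
        ∃ c : ℝ, ∀ u ∈ U, RelGeom.gaussCurvature x ξ u = c)) ∧
    (3 ≤ n →
      ((∀ u ∈ U, ∀ v : RelGeom.E n,
          inner ℝ (RelGeom.beltrami (RelGeom.relativeMetric x ξ y) x u)
            (fderiv ℝ ξ u v) = 0) ↔
        ∃ c : ℝ, c ≠ 0 ∧ ∀ u ∈ U, RelGeom.supportFunction ξ y u =
          c * |RelGeom.gaussCurvature x ξ u| ^ (1 / (2 - (n : ℝ))))) := by
  constructor
  · rintro rfl
    rw [RelGeom.inner_beltrami_fderiv_eq_zero_iff le_rfl hUo hUc hx hξ hK hy]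
    simp
  · intro hn
    have hexp : 1 / (2 - (n : ℝ)) = -(1 / ((n - 2 : ℕ) : ℝ)) := by
      rw [Nat.cast_sub (by omega), Nat.cast_ofNat, ← neg_sub, one_div_neg_eq_neg_one_div]
    rw [RelGeom.inner_beltrami_fderiv_eq_zero_iff (by omega) hUo hUc hx hξ hK hy, hexp]
    exact RelGeom.exists_mul_pow_eq_iff hUc
      (fun u hu =>
        (RelGeom.differentiableAt_gaussCurvature hUo hx hξ hu).continuousAt.continuousWithinAt)
      (RelGeom.contDiffOn_supportFunction hξ hy).continuousOn hK
      (fun u hu => RelGeom.supportFunction_ne_zero hx hξ hy hu) (by omega)
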